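/- Let $F$ be a finite field and let $K$ be a function field, i.e. a finitely generated extension of $F$ of transcendence degree $1$, with field of constants $F_K$ (the algebraic closure of $F$ in $K$). For a place $v$ of $K$ (a normalized discrete valuation), let $K_v$ be the completion and $f_v=[k_v:F_K]$ the degree of the residue field. For an idele $x=(x_v)$ of $K$ put $\deg_K(x)=\sum_v f_v\,v(x_v)$. Let $L/K$ be a finite Galois extension with group $G$. For an algebraic torus $T$ over $K$ split by $L$, let $X(T)$ be its character group, a $G$-module, so that $X(T)^G$ is the group of $K$-morphisms $T\to\mathbf G_m$. Let $T(\mathbf A_K)$ be the group of families $(t_v)\in\prod_v T(K_v)$ such that $t_v$ lies in the maximal compact subgroup of $T(K_v)$ for almost all $v$. Define $$\deg_T: T(\mathbf A_K)\to \mathrm{Hom}(X(T)^G,\mathbf Z),\qquad t\mapsto\big(m\mapsto \deg_K(m(t))\big),$$ and denote by $\mathcal D_T$ the image and by $\mathcal C_T$ the cokernel of $\deg_T$. A morphism of tori $T'\to T$ induces $\mathrm{Hom}(X(T')^G,\mathbf Z)\to\mathrm{Hom}(X(T)^G,\mathbf Z)$, which maps $\mathcal D_{T'}$ into $\mathcal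 D_T$. Let $T_Q\to T_P\to T$ be morphisms of $K$-tori split by $L$, with $P=X(T_P)$ and $Q=X(T_Q)$, such that the induced sequence of $G$-modules $$0\to X(T)\to P\to Q\to 0$$ is a flasque resolution of $X(T)$: it is exact, $P$ is a permutation module (it has a finite $\mathbf Z$-basis permuted by $G$), and $Q$ is flasque ($\widehat H^{-1}(H,Q)=0$ for every subgroup $H$ of $G$). Let $\mathcal K_T$ be the cardinality of the cokernel of $\mathcal D_{T_P}\to\mathcal D_T$. Then $$\mathcal D_{T_Q}\to\mathcal D_{T_P}\to\mathcal D_T$$ is a complex; the groups $H^1(G,X(T))$, $\mathcal C_T$, $\mathcal C_{T_P}$, $\mathcal C_{T_Q}$, the cokernel of $\mathcal D_{T_P}\to\mathcal D_T$ and the homology of the complex at $\mathcal D_{T_P}$ are finite; and this homology has cardinality $$\frac{|H^1(G,X(T))|\;|\mathcal C_{T_Q}|\;|\mathcal C_T|\;\mathcal K_T}{|\mathcal C_{T_P}|}.$$ -/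

import Mathlib

open TensorProduct

noncomputable section

/-! ### Function fields, places and completions -/

/-- `K` is a function field (global field of positive characteristic, once `F` is finite): a
finitely generated field extension of `F` of transcendence degree one. -/
structure IsFunctionField (F K : Type*) [Field F] [Field K] [Algebra F K] : Prop where
  fg : (⊤ : IntermediateField F K).FG
  trdeg_eq_one : Algebra.trdeg F K = 1

/-- The places of a function field `K`, each represented by the unique normalized discrete
valuation (value group exactly `ℤ`, written multiplicatively) attached to it. -/
structure Place (K : Type*) [Field K] where
  /-- The normalized valuation. -/
  valuation : Valuation K (WithZero (Multiplicative ℤ))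
  surjective : Function.Surjective valuation

namespace Place

variable {K : Type*} [Field K]

/-- The completion `K_v`. -/
abbrev Completion (v : Place K) : Type _ := v.valuation.Completion

instance (v : Place K) : Algebra K v.Completion :=
  ((UniformSpace.Completion.coeRingHom (α := WithVal v.valuation)).comp
    (WithVal.equiv v.valuation).symm.toRingHom).toAlgebra

/-- The normalized additive valuation `ord_v : K_v → ℤ` (with junk value `0` at `0`). -/
def ord (v : Place K) (x : v.Completion) : ℤ :=
  -WithZero.log (Valued.v x : WithZero (Multiplicative ℤ))

theorem ord_mul (v : Place K) {x y : v.Completion} (hx : x ≠ 0) (hy : y ≠ 0) :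
    v.ord (x * y) = v.ord x + v.ord y := by
  have hx' : (Valued.v x : WithZero (Multiplicative ℤ)) ≠ 0 := by simpa using hx
  have hy' : (Valued.v y : WithZero (Multiplicative ℤ)) ≠ 0 := by simpa using hy
  simp only [ord, map_mul, WithZero.log_mul hx' hy']
  ring

open scoped WithZeroTopology in
/-- The normalized valuation is bounded below on compact subsets of `K_v`. -/
theorem exists_le_ord (v : Place K) {S : Set v.Completion} (hS : IsCompact S) :
    ∃ n : ℤ, ∀ x ∈ S, x ≠ 0 → n ≤ v.ord x := by
  have hc : IsClosed S := hS.isClosed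
  have hcont := Valued.continuous_valuation_of_surjective
    (hv := (inferInstance : Valued v.Completion (WithZero (Multiplicative ℤ))))
      (Valued.valuedCompletion_surjective_iff.mpr fun γ => by
        obtain ⟨x, hx⟩ := v.surjective γ
        exact ⟨WithVal.toVal v.valuation x, hx⟩)
  obtain ⟨n, hn⟩ := hS.elim_directed_cover
    (fun n : ℕ => {x : v.Completion | (Valued.v x : WithZero (Multiplicative ℤ)) <
      WithZero.exp (n : ℤ)})
    (fun n => WithZeroTopology.isOpen_Iio.preimage hcont)
    (fun x _ => by
      rw [Set.mem_iUnion]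
      by_cases hx : x = 0
      · exact ⟨0, by simp [hx]⟩
      · have hx' : (Valued.v x : WithZero (Multiplicative ℤ)) ≠ 0 := by simpa using hx
        refine ⟨(WithZero.log (Valued.v x : WithZero (Multiplicative ℤ))).toNat + 1, ?_⟩
        rw [Set.mem_ofPred_eq, ← WithZero.log_lt_iff_lt_exp hx']
        push_cast
        omega)
    (directed_of_isDirected_le fun i j hij x hx => by
      refine lt_of_lt_of_le (Set.mem_ofPred_eq ▸ hx) ?_
      rw [WithZero.exp_le_exp]
      exact_mod_cast hij)
  refine ⟨-n, fun x hx hx0 => ?_⟩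
  have hx' : (Valued.v x : WithZero (Multiplicative ℤ)) ≠ 0 := by simpa using hx0
  have h := (WithZero.log_lt_iff_lt_exp hx').mpr (hn hx)
  simp only [ord]
  omega

variable (F : Type*) [Field F] [Finite F] [Algebra F K]

/-- The field of constants `F_K`, which is the set of elements of `K` algebraic over the finite
field `F`, is contained in the valuation ring of every place. -/
theorem le_one_of_constant (v : Place K) (x : algebraicClosure F K) : v.valuation (x : K) ≤ 1 := by
  have hF : Algebra.IsIntegral ℤ F := Algebra.IsIntegral.of_finite ℤ F
  have h1 : IsIntegral F (x : K) := (mem_algebraicClosure_iff.mp x.2).isIntegral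
  have h2 : IsIntegral ℤ (x : K) := isIntegral_trans (x : K) h1
  exact (Valuation.integer.integers v.valuation).mem_of_integral
    (h2.tower_top (A := v.valuation.integer))

/-- The inclusion of the field of constants in the valuation ring of `v`. -/
def constantsHom (v : Place K) : algebraicClosure F K →+* v.valuation.valuationSubring :=
  (algebraMap (algebraicClosure F K) K).codRestrict v.valuation.valuationSubring.toSubring
    (fun x => v.le_one_of_constant F x)

/-- The absolute residue degree `f_v = [k_v : F_K]`: the degree of the residue field of `v` over
the field of constants of `K`. -/
def residueDegree (v : Place K) : ℕ :=
  letI : Module (algebraicClosure F K) (IsLocalRing.ResidueField v.valuation.valuationSubring) :=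
    ((IsLocalRing.residue v.valuation.valuationSubring).comp (v.constantsHom F)).toModule
  Module.finrank (algebraicClosure F K) (IsLocalRing.ResidueField v.valuation.valuationSubring)

end Place

/-! ### Tori, given by their Hopf algebras of regular functions -/

/-- The affine `K`-group `T = Spec A` is an algebraic torus split by `L`: over `L` its Hopf algebra
becomes isomorphic to that of `𝔾_m ^ d`, the Laurent polynomial algebra `L[ℤ ^ d]`. -/
def IsTorusSplitBy (K L A : Type*) [Field K] [Field L] [Algebra K L] [CommRing A]
    [HopfAlgebra K A] : Prop :=
  ∃ d : ℕ, Nonempty ((L ⊗[K] A) ≃ₐc[L] AddMonoidAlgebra L (Fin d → ℤ))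

/-- The map induced on group-like elements by a morphism of bialgebras. -/
def groupLikeMap {R A B : Type*} [CommRing R] [CommRing A] [CommRing B] [Bialgebra R A]
    [Bialgebra R B] (f : A →ₐc[R] B) : GroupLike R A →* GroupLike R B where
  toFun a := ⟨f a.val, a.isGroupLikeElem_val.map f⟩
  map_one' := by ext; simp
  map_mul' a b := by ext; simp

/-- The group `X(T)` of characters of `T = Spec A` defined over `L`: a morphism of `L`-groups
`T_L → 𝔾_m` is the same as a group-like element of `L ⊗ A`. If `L` splits `T` these are all the
characters of `T`. -/
abbrev CharacterGroup (K L A : Type*) [Field K] [Field L] [Algebra K L] [CommRing A]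
    [HopfAlgebra K A] : Type _ :=
  GroupLike L (L ⊗[K] A)

section Galois

variable {K L A B : Type*} [Field K] [Field L] [Algebra K L] [CommRing A] [HopfAlgebra K A]
  [CommRing B] [HopfAlgebra K B]

/-- The action `σ ⊗ id` of an automorphism `σ` of `L / K` on `L ⊗ A`. -/
def galoisTwist (A : Type*) [CommRing A] [HopfAlgebra K A] (σ : L ≃ₐ[K] L) :
    L ⊗[K] A →ₐ[K] L ⊗[K] A :=
  Algebra.TensorProduct.map (σ : L →ₐ[K] L) (AlgHom.id K A)

theorem galoisTwist_smul (σ : L ≃ₐ[K] L) (c : L) (x : L ⊗[K] A) :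
    galoisTwist A σ (c • x) = σ c • galoisTwist A σ x := by
  induction x with
  | zero => simp
  | add x y hx hy => simp only [smul_add, map_add, hx, hy]
  | tmul a b => simp [galoisTwist, TensorProduct.smul_tmul']

theorem isGroupLikeElem_galoisTwist (σ : L ≃ₐ[K] L) {x : L ⊗[K] A}
    (hx : IsGroupLikeElem L x) : IsGroupLikeElem L (galoisTwist A σ x) where
  counit_eq_one := by
    have h : ∀ y : L ⊗[K] A, Coalgebra.counit (R := L) (galoisTwist A σ y) =
        σ (Coalgebra.counit (R := L) y) := by
      intro y
      induction y with
      | zero => simp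
      | add y z hy hz => simp only [map_add, hy, hz]
      | tmul a b => simp [galoisTwist]
    rw [h, hx.counit_eq_one, map_one]
  comul_eq_tmul_self := by
    let τ : L ⊗[K] A →ₛₗ[(σ : L →+* L)] L ⊗[K] A :=
      { toFun := galoisTwist A σ
        map_add' := map_add _
        map_smul' := galoisTwist_smul σ }
    have h : ∀ y : L ⊗[K] A, Coalgebra.comul (R := L) (galoisTwist A σ y) =
        TensorProduct.map τ τ (Coalgebra.comul (R := L) y) := by
      intro y
      induction y with
      | zero => simp
      | add y z hy hz => simp only [map_add, hy, hz]
      | tmul a b =>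
        have h1 : galoisTwist A σ (a ⊗ₜ[K] b) = σ a ⊗ₜ[K] b := rfl
        rw [h1, TensorProduct.comul_tmul, TensorProduct.comul_tmul]
        induction Coalgebra.comul (R := K) b with
        | zero => simp
        | add y z hy hz => simp only [TensorProduct.tmul_add, map_add, hy, hz]
        | tmul y z =>
          have h2 : τ (1 ⊗ₜ[K] y) = 1 ⊗ₜ[K] y :=
            congrArg (· ⊗ₜ[K] y) (map_one σ)
          have h3 : τ (a ⊗ₜ[K] z) = σ a ⊗ₜ[K] z := rfl
          simp [TensorProduct.AlgebraTensorModule.tensorTensorTensorComm_tmul, h2, h3]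
    rw [h, hx.comul_eq_tmul_self]
    rfl

/-- The action of the Galois group on the character group. -/
instance : MulDistribMulAction (L ≃ₐ[K] L) (CharacterGroup K L A) where
  smul σ χ := ⟨galoisTwist A σ χ.val, isGroupLikeElem_galoisTwist σ χ.isGroupLikeElem_val⟩
  one_smul χ := by
    ext
    change galoisTwist A (1 : L ≃ₐ[K] L) χ.val = χ.val
    exact DFunLike.congr_fun (Algebra.TensorProduct.map_id (R := K) (S := K) (A := L) (B := A)) _
  mul_smul σ τ χ := by
    ext
    change galoisTwist A (σ * τ) χ.val = galoisTwist A σ (galoisTwist A τ χ.val)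
    rw [galoisTwist, galoisTwist, galoisTwist, ← AlgHom.comp_apply,
      ← Algebra.TensorProduct.map_comp]
    rfl
  smul_mul σ χ ψ := by
    ext
    exact map_mul (galoisTwist A σ) χ.val ψ.val
  smul_one σ := by
    ext
    exact map_one (galoisTwist A σ)

variable (L) in
/-- The map `X(T) → X(T')` induced by a morphism of tori `T' → T`, given by a morphism of Hopf
algebras `A → B`. -/
def characterMap (f : A →ₐc[K] B) : CharacterGroup K L A →* CharacterGroup K L B :=
  groupLikeMap (Bialgebra.TensorProduct.map (BialgHom.id L L) f)

end Galois

/-! ### Modules over a finite group (written multiplicatively) -/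

section Modules

variable (G M : Type*) [Group G] [CommGroup M] [MulDistribMulAction G M]

/-- The group of `1`-cocycles of `G` with values in `M`. -/
def oneCocycles : Subgroup (G → M) where
  carrier := {c | groupCohomology.IsMulCocycle₁ c}
  one_mem' g h := by simp
  mul_mem' {c d} hc hd g h := by
    simp only [Pi.mul_apply, hc g h, hd g h, smul_mul']
    exact mul_mul_mul_comm _ _ _ _
  inv_mem' {c} hc g h := by
    simp only [Pi.inv_apply, hc g h, smul_inv', mul_inv]

/-- The group of `1`-coboundaries of `G` with values in `M`. -/
def oneCoboundaries : Subgroup (G → M) where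
  carrier := {c | groupCohomology.IsMulCoboundary₁ c}
  one_mem' := ⟨1, fun g => by simp⟩
  mul_mem' := by
    rintro c d ⟨x, hx⟩ ⟨y, hy⟩
    exact ⟨x * y, fun g => by rw [Pi.mul_apply, ← hx g, ← hy g, smul_mul', mul_div_mul_comm]⟩
  inv_mem' := by
    rintro c ⟨x, hx⟩
    exact ⟨x⁻¹, fun g => by rw [Pi.inv_apply, ← hx g, smul_inv', inv_div_inv, inv_div]⟩

/-- The first cohomology group `H¹(G, M)`: cocycles modulo coboundaries. -/
abbrev FirstCohomology : Type _ :=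
  oneCocycles G M ⧸ (oneCoboundaries G M).subgroupOf (oneCocycles G M)

/-- `M` is a permutation module: it has a finite `ℤ`-basis which is permuted by `G`. -/
def IsPermutationModule : Prop :=
  ∃ (n : ℕ) (b : Module.Basis (Fin n) ℤ (Additive M)),
    ∀ (g : G) (i : Fin n), ∃ j : Fin n, g • (b i).toMul = (b j).toMul

/-- `M` is flasque: for every subgroup `H` of `G` the Tate cohomology group `Ĥ⁻¹(H, M)` vanishes,
that is, every element of `M` killed by the norm of `H` lies in the subgroup generated by the
elements `h m - m` with `h ∈ H` and `m ∈ M`. -/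
def IsFlasqueModule : Prop :=
  ∀ (H : Subgroup G) (m : M), ∏ᶠ h : H, (h : G) • m = 1 →
    m ∈ Subgroup.closure {x : M | ∃ h ∈ H, ∃ y : M, x = h • y / y}

end Modules

/-- Let `T_Q → T_P → T` be morphisms of tori, given by morphisms of Hopf algebras `A → B → C`.
The induced sequence of characters `0 → X(T) → X(T_P) → X(T_Q) → 0` is a flasque resolution of
`X(T)`: it is exact, `X(T_P)` is a permutation module and `X(T_Q)` is flasque. -/
structure IsFlasqueResolution {K : Type*} (L : Type*) {A B C : Type*} [Field K] [Field L]
    [Algebra K L] [CommRing A] [HopfAlgebra K A] [CommRing B] [HopfAlgebra K B] [CommRing C]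
    [HopfAlgebra K C] (γ : A →ₐc[K] B) (π : B →ₐc[K] C) : Prop where
  injective : Function.Injective (characterMap L γ)
  exact : (characterMap L γ).range = (characterMap L π).ker
  surjective : Function.Surjective (characterMap L π)
  permutation : IsPermutationModule (L ≃ₐ[K] L) (CharacterGroup K L B)
  flasque : IsFlasqueModule (L ≃ₐ[K] L) (CharacterGroup K L C)

/-! ### Adelic points and the degree -/

section Degree

variable (F : Type*) {K : Type*} [Field F] [Finite F] [Field K] [Algebra F K]
variable (A : Type*) {B C : Type*} [CommRing A] [HopfAlgebra K A] [CommRing B] [HopfAlgebra K B]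
  [CommRing C] [HopfAlgebra K C]

/-- The group `T(K_v)` of `K_v`-points of `T = Spec A`. -/
abbrev LocalPoints (v : Place K) : Type _ := WithConv (A →ₐ[K] v.Completion)

/-- The group structure of `T(K_v)`: convolution, with inverse given by the antipode. -/
instance (v : Place K) : Group (LocalPoints A v) where
  inv t := WithConv.toConv (t.ofConv.comp (HopfAlgebra.antipodeAlgHom K A))
  inv_mul_cancel t := by
    apply WithConv.ofConv_injective
    ext a
    have h := AlgHom.convMul_apply
      (WithConv.toConv (t.ofConv.comp (HopfAlgebra.antipodeAlgHom K A))) t a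
    refine h.trans ?_
    have h2 : Algebra.TensorProduct.lift
        (t.ofConv.comp (HopfAlgebra.antipodeAlgHom K A)) t.ofConv (fun _ _ => .all ..) =
        (t.ofConv.comp (Algebra.TensorProduct.lmul' K)).comp
          (Algebra.TensorProduct.map (HopfAlgebra.antipodeAlgHom K A) (AlgHom.id K A)) := by
      ext <;> simp
    refine (DFunLike.congr_fun h2 _).trans ?_
    have h3 := HopfAlgebra.mul_antipode_rTensor_comul_apply (R := K) a
    exact (congrArg t.ofConv h3).trans (t.ofConv.commutes _)

/-- The map `T(K_v) → K_v ^ A` recording the values of all regular functions. The topology of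
`T(K_v)` is the one induced by the product topology. -/
def LocalPoints.values (v : Place K) (t : LocalPoints A v) : A → v.Completion :=
  fun a => t.ofConv a

instance (v : Place K) : TopologicalSpace (LocalPoints A v) :=
  TopologicalSpace.induced (LocalPoints.values A v) inferInstance

/-- The maximal compact subgroup `T(O_v)` of `T(K_v)`: the subgroup generated by all the compact
subgroups. -/
def maximalCompact (v : Place K) : Subgroup (LocalPoints A v) :=
  sSup {U | IsCompact (U : Set (LocalPoints A v))}

/-- The adelic points `T(𝔸_K)`: the families of local points which lie in `T(O_v)` for almost all
places `v`. -/
abbrev AdelicPoints : Type _ :=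
  RestrictedProduct (fun v : Place K => LocalPoints A v)
    (fun v : Place K => (maximalCompact A v : Set (LocalPoints A v))) Filter.cofinite

variable (K) in
/-- The group `X(T)^G` of characters of `T = Spec A` defined over `K` (morphisms of `K`-groups
`T → 𝔾_m`, i.e. group-like elements of `A`), in additive notation. -/
abbrev RationalCharacters : Type _ := Additive (GroupLike K A)

variable {A}

theorem evalChar_ne_zero (v : Place K) (t : LocalPoints A v) (m : GroupLike K A) :
    t.ofConv m.val ≠ 0 :=
  (m.isGroupLikeElem_val.isUnit.map t.ofConv).ne_zero

theorem evalChar_mul (v : Place K) (s t : LocalPoints A v) (m : GroupLike K A) :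
    (s * t).ofConv m.val = s.ofConv m.val * t.ofConv m.val := by
  have h := AlgHom.convMul_apply s t m.val
  rw [m.isGroupLikeElem_val.comul_eq_tmul_self, Algebra.TensorProduct.lift_tmul] at h
  exact h

/-- The local degree `t ↦ ord_v (m(t))` attached to a rational character `m`. -/
def localDegree (v : Place K) (m : GroupLike K A) : LocalPoints A v →* Multiplicative ℤ :=
  MonoidHom.mk' (fun t => Multiplicative.ofAdd (v.ord (t.ofConv m.val))) fun s t => by
    rw [evalChar_mul, Place.ord_mul v (evalChar_ne_zero v s m) (evalChar_ne_zero v t m), ofAdd_add]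

/-- Rational characters take unit values on the maximal compact subgroup. -/
theorem ord_eq_zero_of_mem_maximalCompact (v : Place K) {t : LocalPoints A v}
    (ht : t ∈ maximalCompact A v) (m : GroupLike K A) : v.ord (t.ofConv m.val) = 0 := by
  have hle : maximalCompact A v ≤ (localDegree v m).ker := by
    refine sSup_le fun U hU t ht => ?_
    have hcont : Continuous (fun t : LocalPoints A v => t.ofConv m.val) :=
      (continuous_apply m.val).comp continuous_induced_dom
    obtain ⟨n, hn⟩ := v.exists_le_ord (IsCompact.image hU hcont)
    have hz : ∀ k : ℤ, n ≤ k * v.ord (t.ofConv m.val) := by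
      intro k
      have h1 := hn _ ⟨t ^ k, U.zpow_mem ht k, rfl⟩ (evalChar_ne_zero v _ m)
      have h2 := congrArg Multiplicative.toAdd (map_zpow (localDegree v m) t k)
      rw [toAdd_zpow, smul_eq_mul] at h2
      exact h1.trans_eq h2
    have h0 : v.ord (t.ofConv m.val) = 0 := by
      by_contra hne
      have h1 := hz ((n - 1) * v.ord (t.ofConv m.val))
      have h2 := hz ((|n| + 1) * -v.ord (t.ofConv m.val))
      have h3 : 1 ≤ v.ord (t.ofConv m.val) * v.ord (t.ofConv m.val) := by
        have := mul_self_pos.mpr hne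
        omega
      have h4 := neg_abs_le n
      have h5 := abs_nonneg n
      nlinarith
    exact h0
  exact hle ht

theorem finite_support_ord (t : AdelicPoints (K := K) A) (m : GroupLike K A) :
    (Function.support fun v : Place K =>
      (v.residueDegree F : ℤ) * v.ord ((t v).ofConv m.val)).Finite := by
  refine Set.Finite.subset (Filter.eventually_cofinite.mp t.2) fun v hv hmem => hv ?_
  exact (congrArg (_ * ·) (ord_eq_zero_of_mem_maximalCompact v hmem m)).trans (mul_zero _)

/-- The degree `deg_K (m(t)) = ∑ f_v ord_v (m(t_v))` of the idele `m(t)`. -/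
def adelicDegree (t : AdelicPoints (K := K) A) (m : GroupLike K A) : ℤ :=
  ∑ᶠ v : Place K, (v.residueDegree F : ℤ) * v.ord ((t v).ofConv m.val)

variable (A) in
/-- The degree morphism `deg_T : T(𝔸_K) → Hom(X(T)^G, ℤ)`, `t ↦ (m ↦ deg_K (m(t)))`. -/
def torusDegree : Additive (AdelicPoints (K := K) A) →+ (RationalCharacters K A →+ ℤ) :=
  AddMonoidHom.mk'
    (fun t => AddMonoidHom.mk' (fun m : RationalCharacters K A =>
      adelicDegree F (Additive.toMul t) (Additive.toMul m)) fun m n => by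
      simp only [adelicDegree]
      rw [← finsum_add_distrib (finite_support_ord F _ _) (finite_support_ord F _ _)]
      refine finsum_congr fun v => ?_
      rw [← mul_add, ← Place.ord_mul v (evalChar_ne_zero v _ _) (evalChar_ne_zero v _ _),
        ← map_mul]
      rfl)
    fun s t => by
      ext m
      change adelicDegree F (Additive.toMul s * Additive.toMul t) m =
        adelicDegree F (Additive.toMul s) m + adelicDegree F (Additive.toMul t) m
      simp only [adelicDegree]
      rw [← finsum_add_distrib (finite_support_ord F _ _) (finite_support_ord F _ _)]
      refine finsum_congr fun v => ?_
      rw [← mul_add, ← Place.ord_mul v (evalChar_ne_zero v _ _) (evalChar_ne_zero v _ _),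
        ← evalChar_mul]
      rfl

variable (K A) in
/-- The image `𝓓_T` of the degree morphism. -/
def degreeImage : AddSubgroup (RationalCharacters K A →+ ℤ) := (torusDegree (K := K) F A).range

variable (K A) in
/-- The cokernel `𝓒_T` of the degree morphism. -/
abbrev DegreeCokernel : Type _ := (RationalCharacters K A →+ ℤ) ⧸ degreeImage F K A

/-- The map `T'(K_v) → T(K_v)` induced by a morphism of tori `T' → T`. -/
def localPointsMap (f : A →ₐc[K] B) (v : Place K) : LocalPoints B v →* LocalPoints A v :=
  MonoidHom.mk' (fun t => WithConv.toConv (t.ofConv.comp (f : A →ₐ[K] B))) fun s t => by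
    exact congrArg WithConv.toConv (AlgHom.convMul_comp_bialgHom_distrib s t f)

theorem localPointsMap_mem (f : A →ₐc[K] B) (v : Place K) {t : LocalPoints B v}
    (ht : t ∈ maximalCompact B v) : localPointsMap f v t ∈ maximalCompact A v := by
  have hle : maximalCompact B v ≤ (maximalCompact A v).comap (localPointsMap f v) := by
    refine sSup_le fun U hU => ?_
    rw [← Subgroup.map_le_iff_le_comap]
    have hcont : Continuous (localPointsMap f v) :=
      continuous_induced_rng.mpr (continuous_pi fun a =>
        (continuous_apply (f a)).comp continuous_induced_dom)
    exact le_sSup (by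
      change IsCompact ((U.map (localPointsMap f v) : Subgroup _) : Set (LocalPoints A v))
      rw [Subgroup.coe_map]
      exact IsCompact.image hU hcont)
  exact hle ht

/-- The map `T'(𝔸_K) → T(𝔸_K)` induced by a morphism of tori `T' → T`. -/
def adelicPointsMap (f : A →ₐc[K] B) (t : AdelicPoints (K := K) B) : AdelicPoints (K := K) A :=
  ⟨fun v => localPointsMap f v (t v), t.2.mono fun v hv => localPointsMap_mem f v hv⟩

/-- The map `Hom(X(T')^G, ℤ) → Hom(X(T)^G, ℤ)` induced by a morphism of tori `T' → T`. -/
def dualCharacterMap (f : A →ₐc[K] B) :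
    (RationalCharacters K B →+ ℤ) →+ (RationalCharacters K A →+ ℤ) :=
  AddMonoidHom.compHom' (groupLikeMap f).toAdditive

/-- The degree is functorial: `deg_T ∘ f = f^∨ ∘ deg_T'`. -/
theorem torusDegree_adelicPointsMap (f : A →ₐc[K] B) (t : AdelicPoints (K := K) B) :
    torusDegree F A (Additive.ofMul (adelicPointsMap f t)) =
      dualCharacterMap f (torusDegree F B (Additive.ofMul t)) :=
  rfl

/-- The map `𝓓_T' → 𝓓_T` induced by a morphism of tori `T' → T`. -/
def degreeImageMap (f : A →ₐc[K] B) : degreeImage F K B →+ degreeImage F K A :=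
  ((dualCharacterMap f).comp (degreeImage F K B).subtype).codRestrict (degreeImage F K A) (by
    rintro ⟨_, t, rfl⟩
    exact ⟨Additive.ofMul (adelicPointsMap f t.toMul), torusDegree_adelicPointsMap F f t.toMul⟩)

/-- For `T_Q → T_P → T`, the homology (at the middle term) of the complex
`𝓓_{T_Q} → 𝓓_{T_P} → 𝓓_T`. -/
abbrev DegreeHomology (γ : A →ₐc[K] B) (π : B →ₐc[K] C) : Type _ :=
  (degreeImageMap F γ).ker ⧸ (degreeImageMap F π).range.addSubgroupOf (degreeImageMap F γ).ker

/-- The cokernel of `𝓓_{T_P} → 𝓓_T`. For a flasque resolution its cardinality is `𝓚_T`. -/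
abbrev DegreeMapCokernel (γ : A →ₐc[K] B) : Type _ :=
  degreeImage F K A ⧸ (degreeImageMap F γ).range

end Degree

end

/-!
The statement is a comparison of two multiplicative Euler characteristics.

Write `X_T = X(T)^G`. Taking invariants of `0 → X(T) → P → Q → 0` gives the exact sequence
`0 → X_T → P^G → Q^G → H¹(G, X(T)) → H¹(G, P) = 0`, the last group being zero because `P` is a
permutation module (`card_firstCohomology_of_exact`). Dually, the complex of lattices
`0 → Hom(Q^G, ℤ) → Hom(P^G, ℤ) → Hom(X_T, ℤ) → 0` is exact except in the middle, and its homology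
there has `|H¹(G, X(T))|` elements: a sublattice of finite index and the dual inclusion have the
same index, since a matrix and its transpose have the same determinant (`relIndex_range_compHom'`).

The groups `𝓓_{T_Q} → 𝓓_{T_P} → 𝓓_T` form a subcomplex. Once they are known to be of finite
index, the Euler characteristic of the lattices is the product of that of the subcomplex and that of
the cokernels `𝓒`, which is the claimed formula
(`AddSubgroup.relIndex_map_mul_index_of_complex`).

Finiteness of `𝓒_T` is the arithmetic part (`degreeImage_index_ne_zero`). Choose a place `v` of `K`
with finite residue field and a uniformizer `x ∈ K` at `v`. A functional `ψ` on `X_T` gives the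
invariant homomorphism `χ ↦ x ^ ψ(N χ)` on `X(T)`, where `N` is the norm of `G`. By Galois descent
it is a point of `T(K)` (`exists_point_of_invariant`), and the adelic point which is equal to it at
`v` and trivial elsewhere has degree `|G| f_v ψ`. So `|G| f_v` kills the finitely generated group
`𝓒_T`.
-/

noncomputable section

/-! ### Indices in complexes of abelian groups -/

/-- Multiplicativity of Euler characteristics, in terms of indices: a subcomplex `DQ → DP → DM` is
compared with a complex `0 → EQ → EP → EM → 0` whose only homology is `ker α / im β`. -/
theorem AddSubgroup.relIndex_map_mul_index_of_complex {EQ EP EM : Type*} [AddCommGroup EQ]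
    [AddCommGroup EP] [AddCommGroup EM] {β : EQ →+ EP} {α : EP →+ EM}
    (hβ : Function.Injective β) (hα : Function.Surjective α) (hαβ : β.range ≤ α.ker)
    {DQ : AddSubgroup EQ} {DP : AddSubgroup EP} {DM : AddSubgroup EM}
    (hβD : DQ.map β ≤ DP) (hαD : DP.map α ≤ DM) :
    (DQ.map β).relIndex (DP ⊓ α.ker) * DP.index =
      β.range.relIndex α.ker * DQ.index * (DM.index * (DP.map α).relIndex DM) := by
  have hle : DQ.map β ≤ β.range := β.range_eq_map ▸ AddSubgroup.map_mono le_top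
  have h1 := relIndex_mul_relIndex (DQ.map β) (DP ⊓ α.ker) α.ker
    (le_inf hβD (hle.trans hαβ)) inf_le_right
  have h2 := relIndex_mul_relIndex (DQ.map β) β.range α.ker hle hαβ
  have h3 : (DQ.map β).relIndex β.range = DQ.index := by
    rw [AddMonoidHom.range_eq_map, relIndex_map_map_of_injective _ _ hβ, relIndex_top_right]
  have h4 : (DP.map α).index = (DP ⊔ α.ker).index := by
    rw [index_map, AddMonoidHom.range_eq_top.mpr hα, index_top, mul_one]
  have h5 : DP.relIndex (DP ⊔ α.ker) = (DP ⊓ α.ker).relIndex α.ker := by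
    rw [relIndex_sup_left, inf_relIndex_right]
  have h6 := relIndex_mul_index (H := DP) (K := DP ⊔ α.ker) le_sup_left
  have h7 := relIndex_mul_index hαD
  rw [h3] at h2
  rw [← h6, h5, ← h4, ← h7, ← mul_assoc, h1, ← h2]
  ring

theorem AddSubgroup.index_ne_zero_of_nsmul_mem {N : Type*} [AddCommGroup N] [Module.Finite ℤ N]
    (D : AddSubgroup N) {n : ℕ} (hn : n ≠ 0) (h : ∀ x : N, n • x ∈ D) : D.index ≠ 0 := by
  have hfin : Finite (N ⧸ D.toIntSubmodule) := by
    apply Module.finite_of_fg_torsion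
    rintro ⟨x⟩
    refine ⟨⟨(n : ℤ), by simpa using hn⟩, ?_⟩
    change (n : ℤ) • (Submodule.Quotient.mk x : N ⧸ D.toIntSubmodule) = 0
    rw [← Submodule.Quotient.mk_smul, Submodule.Quotient.mk_eq_zero]
    exact (natCast_zsmul x n).symm ▸ h x
  have : Finite (N ⧸ D) := hfin
  exact index_ne_zero_of_finite

open Module in
/-- A subgroup of finite index in a lattice and its image under duality have the same index:
the determinant of an endomorphism is that of its transpose. -/
theorem index_range_dual_subtype {N : Type*} [AddCommGroup N] [Module.Free ℤ N]
    [Module.Finite ℤ N] (I : Submodule ℤ N) [Finite (N ⧸ I)] :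
    Nat.card (Dual ℤ I ⧸ LinearMap.range I.subtype.dualMap) = Nat.card (N ⧸ I) := by
  have hrk : finrank ℤ N = finrank ℤ I := ((Submodule.finiteQuotient_iff I).mp inferInstance).symm
  let e : N ≃ₗ[ℤ] I := LinearEquiv.ofFinrankEq N I hrk
  let f : N →ₗ[ℤ] N := I.subtype ∘ₗ e.toLinearMap
  have hcard : f.det.natAbs = Nat.card (N ⧸ I) := Submodule.natAbs_det_equiv I e
  have hinj : Function.Injective f.dualMap := by
    refine (injective_iff_map_eq_zero f.dualMap).mpr fun φ hφ => LinearMap.ext fun x => ?_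
    have hx : Nat.card (N ⧸ I) • x ∈ I := by
      rw [← Submodule.Quotient.mk_eq_zero, Submodule.Quotient.mk_smul, card_nsmul_eq_zero']
    obtain ⟨y, hy⟩ := e.surjective ⟨_, hx⟩
    have h := LinearMap.congr_fun hφ y
    have h2 : f y = Nat.card (N ⧸ I) • x := congrArg Subtype.val hy
    rw [LinearMap.dualMap_apply, h2, map_nsmul, LinearMap.zero_apply, smul_eq_zero] at h
    exact h.resolve_left Nat.card_pos.ne'
  have h2 : f.dualMap.det.natAbs = Nat.card (Dual ℤ N ⧸ LinearMap.range f.dualMap) :=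
    Submodule.natAbs_det_equiv _ (LinearEquiv.ofInjective f.dualMap hinj)
  rw [LinearMap.det_dualMap, hcard] at h2
  rw [h2]
  exact Nat.card_congr (Submodule.Quotient.equiv _ _ e.dualMap
    (LinearMap.range_comp I.subtype.dualMap e.dualMap.toLinearMap).symm).toEquiv

/-- Dualizing an exact sequence `M → P → Q` of lattices, the homology at `Hom(P, ℤ)` has as many
elements as the cokernel of `P → Q`, provided the latter is finite. -/
theorem relIndex_range_compHom' {M P Q : Type*} [AddCommGroup M] [AddCommGroup P] [AddCommGroup Q]
    [Module.Free ℤ Q] [Module.Finite ℤ Q] {g : M →+ P} {f : P →+ Q} (hgf : g.range = f.ker)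
    (hf : f.range.index ≠ 0) :
    (AddMonoidHom.compHom' f : (Q →+ ℤ) →+ (P →+ ℤ)).range.relIndex
      (AddMonoidHom.compHom' g : (P →+ ℤ) →+ (M →+ ℤ)).ker = f.range.index := by
  let I : Submodule ℤ Q := f.range.toIntSubmodule
  have : f.range.FiniteIndex := ⟨hf⟩
  have : Finite (Q ⧸ I) := AddSubgroup.finite_quotient_of_finiteIndex (H := f.range)
  let f' : P →+ I := f.rangeRestrict
  have hf' : Function.Surjective f' := f.rangeRestrict_surjective
  let ψ : (I →ₗ[ℤ] ℤ) →+ (P →+ ℤ) :=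
    AddMonoidHom.mk' (fun φ => φ.toAddMonoidHom.comp f') fun φ φ' => rfl
  have hψ : Function.Injective ψ := fun φ φ' h =>
    LinearMap.ext fun x => by
      obtain ⟨p, rfl⟩ := hf' x
      exact DFunLike.congr_fun h p
  have hker : (AddMonoidHom.compHom' g : (P →+ ℤ) →+ (M →+ ℤ)).ker = ψ.range := by
    ext φ
    constructor
    · intro hφ
      have hle : f'.ker ≤ φ.ker := by
        intro p hp
        have hp' : p ∈ g.range := hgf ▸ (congrArg Subtype.val hp : f p = 0)
        obtain ⟨m, rfl⟩ := hp'
        exact DFunLike.congr_fun hφ m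
      refine ⟨(f'.liftOfSurjective hf' ⟨φ, hle⟩).toIntLinearMap, ?_⟩
      ext p
      exact f'.liftOfRightInverse_comp_apply _ (Function.rightInverse_surjInv hf') ⟨φ, hle⟩ p
    · rintro ⟨χ, rfl⟩
      ext m
      have h0 : f (g m) = 0 := hgf.le ⟨m, rfl⟩
      have : f' (g m) = 0 := Subtype.ext h0
      change χ (f' (g m)) = 0
      rw [this, map_zero]
  have hrange : (AddMonoidHom.compHom' f : (Q →+ ℤ) →+ (P →+ ℤ)).range =
      (LinearMap.range I.subtype.dualMap).toAddSubgroup.map ψ := by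
    ext φ
    constructor
    · rintro ⟨χ, rfl⟩
      exact ⟨_, ⟨χ.toIntLinearMap, rfl⟩, rfl⟩
    · rintro ⟨_, ⟨χ, rfl⟩, rfl⟩
      exact ⟨χ.toAddMonoidHom, rfl⟩
  rw [hker, hrange, AddMonoidHom.range_eq_map, AddSubgroup.relIndex_map_map_of_injective _ _ hψ,
    AddSubgroup.relIndex_top_right]
  exact index_range_dual_subtype I

/-- A functional on `M` extends to `P`, because `P ⧸ M` is a lattice. -/
theorem compHom'_surjective_of_exact {M P Q : Type*} [AddCommGroup M] [AddCommGroup P]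
    [AddCommGroup Q] [Module.Free ℤ Q] [Module.Finite ℤ Q] {g : M →+ P} {f : P →+ Q}
    (hg : Function.Injective g) (hgf : g.range = f.ker) :
    Function.Surjective (AddMonoidHom.compHom' g : (P →+ ℤ) →+ (M →+ ℤ)) := by
  intro φ
  let f' : P →ₗ[ℤ] LinearMap.range f.toIntLinearMap := f.toIntLinearMap.rangeRestrict
  -- The image of `P` in `Q` is free, so that `P → Q` splits over it.
  obtain ⟨s, hs⟩ := Module.projective_lifting_property f' LinearMap.id
    f.toIntLinearMap.surjective_rangeRestrict
  have hmem : ∀ p : P, p - s (f' p) ∈ g.range := by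
    intro p
    rw [hgf, AddMonoidHom.mem_ker, map_sub, sub_eq_zero]
    exact (congrArg Subtype.val (LinearMap.congr_fun hs (f' p))).symm
  let r : P →+ g.range :=
    ((AddMonoidHom.id P) - (s.comp f').toAddMonoidHom).codRestrict g.range hmem
  let e := AddMonoidHom.ofInjective hg
  refine ⟨φ.comp (e.symm.toAddMonoidHom.comp r), ?_⟩
  ext m
  change φ (e.symm (r (g m))) = φ m
  have h0 : f (g m) = 0 := hgf.le ⟨m, rfl⟩
  have h1 : f' (g m) = 0 := Subtype.ext h0
  have h2 : r (g m) = e m := by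
    apply Subtype.ext
    change g m - s (f' (g m)) = g m
    rw [h1, map_zero, sub_zero]
  rw [h2, e.symm_apply_apply]

/-! ### First cohomology -/

section Cohomology

variable {G M P Q : Type*} [Group G] [CommGroup M] [MulDistribMulAction G M]
  [CommGroup P] [MulDistribMulAction G P] [CommGroup Q] [MulDistribMulAction G Q]

/-- `H¹(G, P) = 0` for a permutation module `P` of a finite group `G` of order `n`.
Summing the cocycle relation gives `n • c g = x - g • x` for some `x`. The coordinates of `x` modulo
`n` are then constant on the orbits of `G`, so that `x` may be replaced by `n • y`, where the
coordinates of `y` are those of `x` divided by `n` and rounded down. -/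
theorem IsPermutationModule.isMulCoboundary₁ [Finite G] (hP : IsPermutationModule G P) {c : G → P}
    (hc : groupCohomology.IsMulCocycle₁ c) : groupCohomology.IsMulCoboundary₁ c := by
  classical
  have := Fintype.ofFinite G
  obtain ⟨n, b, hb⟩ := hP
  choose τ hτ using hb
  -- The action in additive notation.
  let ρ : G → (Additive P →+ Additive P) := fun g =>
    (MulDistribMulAction.toMonoidHom P g).toAdditive
  have hρb : ∀ g i, ρ g (b i) = b (τ g i) := fun g i => hτ g i
  have hρ1 : ∀ x, ρ 1 x = x := fun x => one_smul G x.toMul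
  have hρm : ∀ g h x, ρ (g * h) x = ρ g (ρ h x) := fun g h x => mul_smul g h x.toMul
  have hτinv : ∀ g i, τ g (τ g⁻¹ i) = i := fun g i => b.injective <| by
    rw [← hρb, ← hρb, ← hρm, mul_inv_cancel, hρ1]
  have hτinv' : ∀ g i, τ g⁻¹ (τ g i) = i := fun g i => by
    simpa using hτinv g⁻¹ i
  let e : G → Equiv.Perm (Fin n) := fun g => ⟨τ g, τ g⁻¹, hτinv' g, hτinv g⟩
  have hcoord : ∀ g x i, b.repr (ρ g x) (τ g i) = b.repr x i := by
    intro g x i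
    have h : (b.coord (τ g i)).comp (ρ g).toIntLinearMap = b.coord i := by
      refine b.ext fun j => ?_
      change b.repr (ρ g (b j)) (τ g i) = b.repr (b j) i
      rw [hρb, b.repr_self, b.repr_self, Finsupp.single_apply, Finsupp.single_apply]
      exact if_congr (e g).injective.eq_iff rfl rfl
    exact LinearMap.congr_fun h x
  let a : G → Additive P := fun g => Additive.ofMul (c g)
  have ha : ∀ g h, a (g * h) = ρ g (a h) + a g := fun g h => congrArg Additive.ofMul (hc g h)
  let x : Additive P := -∑ h, a h
  have hx : ∀ g, ρ g x - x = (Fintype.card G : ℤ) • a g := by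
    intro g
    have h1 : ∑ h, a h = ∑ h, a (g * h) := (Equiv.sum_comp (Equiv.mulLeft g) a).symm
    have h2 : ∑ h, a (g * h) = ρ g (∑ h, a h) + (Fintype.card G : ℤ) • a g := by
      simp only [ha, Finset.sum_add_distrib, map_sum, Finset.sum_const, Finset.card_univ,
        natCast_zsmul]
    rw [h2] at h1
    simp only [x, map_neg]
    rw [neg_sub_neg, sub_eq_iff_eq_add', ← h1]
  have hN : (Fintype.card G : ℤ) ≠ 0 := by simp
  let y : Additive P := ∑ i, (b.repr x i / (Fintype.card G : ℤ)) • b i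
  have hy : ∀ i, b.repr y i = b.repr x i / (Fintype.card G : ℤ) := fun i => by
    simp [y, Finsupp.single_apply]
  refine ⟨y.toMul, fun g => ?_⟩
  change ρ g y - y = a g
  refine b.repr.injective (Finsupp.ext fun j => ?_)
  obtain ⟨i, rfl⟩ := (e g).surjective j
  change b.repr (ρ g y - y) (τ g i) = b.repr (a g) (τ g i)
  have h1 := congrArg (fun z => b.repr z (τ g i)) (hx g)
  simp only [map_sub, map_smul, Finsupp.sub_apply, Finsupp.smul_apply, hcoord, smul_eq_mul] at h1
  rw [map_sub, Finsupp.sub_apply, hcoord, hy, hy, sub_eq_iff_eq_add.mp h1, add_comm,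
    Int.add_mul_ediv_left _ _ hN, add_sub_cancel_left]

/-- The end `P^G → Q^G → H¹(G, M) → H¹(G, P) = 0` of the long exact cohomology sequence, in terms of
indices. -/
theorem card_firstCohomology_of_exact {i : M →* P} {j : P →* Q} [Finite G]
    (hi : Function.Injective i) (hij : i.range = j.ker) (hj : Function.Surjective j)
    (hiG : ∀ (g : G) m, i (g • m) = g • i m) (hjG : ∀ (g : G) p, j (g • p) = g • j p)
    (hP : IsPermutationModule G P) :
    Nat.card (FirstCohomology G M) =
      ((FixedPoints.subgroup G P).map j).relIndex (FixedPoints.subgroup G Q) := by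
  -- The elements of `P` with invariant image in `Q` give rise to the cocycles `g ↦ g p / p`.
  let S : Subgroup P := (FixedPoints.subgroup G Q).comap j
  have hS : ∀ p ∈ S, ∀ g : G, g • p / p ∈ i.range := by
    intro p hp g
    rw [hij, MonoidHom.mem_ker, map_div, hjG, hp g, div_self']
  choose! d hd using hS
  have hdmem : ∀ p : S, d p.1 ∈ oneCocycles G M := by
    intro p g h
    apply hi
    rw [map_mul, hiG, hd p.1 p.2, hd p.1 p.2, hd p.1 p.2, smul_div', mul_smul,
      div_mul_div_cancel]
  let δ : S →* oneCocycles G M := MonoidHom.mk' (fun p => ⟨d p.1, hdmem p⟩) fun p q => by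
    refine Subtype.ext (funext fun g => hi ?_)
    change i (d (p * q).1 g) = i (d p.1 g * d q.1 g)
    rw [map_mul, hd _ (p * q).2, hd _ p.2, hd _ q.2, Subgroup.coe_mul, smul_mul',
      mul_div_mul_comm]
  have hδ : ∀ (p : S) g, i ((δ p).1 g) = g • p.1 / p.1 := fun p g => hd p.1 p.2 g
  have hδsurj : Function.Surjective δ := by
    rintro ⟨c, hc⟩
    have hic : groupCohomology.IsMulCocycle₁ (fun g => i (c g)) := fun g h => by
      change i (c (g * h)) = g • i (c h) * i (c g)
      rw [hc g h, map_mul, hiG]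
    obtain ⟨p, hp⟩ := hP.isMulCoboundary₁ hic
    have hpS : p ∈ S := fun g => by
      have h1 : g • p / p ∈ j.ker := hij ▸ ⟨c g, (hp g).symm⟩
      rw [MonoidHom.mem_ker, map_div, hjG, div_eq_one] at h1
      exact h1
    exact ⟨⟨p, hpS⟩, Subtype.ext (funext fun g => hi ((hδ ⟨p, hpS⟩ g).trans (hp g)))⟩
  let θ : S →* FixedPoints.subgroup G Q := j.subgroupComap _
  have hθsurj : Function.Surjective θ := j.subgroupComap_surjective_of_surjective _ hj
  have hcomap : ((oneCoboundaries G M).subgroupOf (oneCocycles G M)).comap δ =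
      (((FixedPoints.subgroup G P).map j).subgroupOf (FixedPoints.subgroup G Q)).comap θ := by
    ext p
    constructor
    · rintro ⟨m, hm⟩
      refine ⟨p.1 / i m, fun g => ?_, ?_⟩
      · have h := congrArg i (hm g)
        rw [map_div, hiG] at h
        rw [smul_div', div_eq_div_iff_div_eq_div, h]
        exact (hδ p g).symm
      · have h1 : i m ∈ j.ker := hij ▸ ⟨m, rfl⟩
        rw [map_div, h1, div_one]
        rfl
    · rintro ⟨q, hq, hqp⟩
      have h1 : p.1 / q ∈ j.ker := by
        rw [MonoidHom.mem_ker, map_div, hqp]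
        exact div_self' _
      rw [← hij] at h1
      obtain ⟨m, hm⟩ := h1
      refine ⟨m, fun g => hi ?_⟩
      rw [map_div, hiG, hm, smul_div', hq g]
      refine Eq.trans ?_ (hδ p g).symm
      rw [div_div_div_cancel_right]
  have h1 := Subgroup.index_comap_of_surjective
    ((oneCoboundaries G M).subgroupOf (oneCocycles G M)) hδsurj
  have h2 := Subgroup.index_comap_of_surjective
    (((FixedPoints.subgroup G P).map j).subgroupOf (FixedPoints.subgroup G Q)) hθsurj
  rw [hcomap] at h1
  exact h1.symm.trans h2

variable (G) in
/-- The norm `m ↦ ∏ g • m` of a finite group `G`, as a homomorphism from `M` to `M^G`. -/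
def groupNorm [Fintype G] : M →* FixedPoints.subgroup G M where
  toFun m := ⟨∏ g : G, g • m, fun h => by
    rw [Finset.smul_prod']
    simp only [smul_smul]
    exact Equiv.prod_comp (Equiv.mulLeft h) fun g => g • m⟩
  map_one' := by ext; simp
  map_mul' m n := by ext; simp [Finset.prod_mul_distrib]

theorem groupNorm_smul [Fintype G] (h : G) (m : M) : groupNorm G (h • m) = groupNorm G m := by
  ext
  change ∏ g : G, g • h • m = ∏ g : G, g • m
  simp only [smul_smul]
  exact Equiv.prod_comp (Equiv.mulRight h) fun g => g • m

theorem groupNorm_of_mem [Fintype G] (m : FixedPoints.subgroup G M) :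
    groupNorm G m.1 = m ^ Fintype.card G := by
  ext
  change ∏ g : G, g • m.1 = _
  rw [Finset.prod_congr rfl fun g _ => m.2 g]
  simp

/-- The norm shows that the order of `G` kills the cokernel of `P^G → Q^G`. -/
theorem pow_card_mem_map_fixedPoints [Fintype G] {j : P →* Q} (hj : Function.Surjective j)
    (hjG : ∀ (g : G) p, j (g • p) = g • j p) {q : Q} (hq : q ∈ FixedPoints.subgroup G Q) :
    q ^ Fintype.card G ∈ (FixedPoints.subgroup G P).map j := by
  obtain ⟨p, rfl⟩ := hj q
  refine ⟨(groupNorm G p).1, (groupNorm G p).2, ?_⟩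
  change j (∏ g : G, g • p) = _
  rw [map_prod, Finset.prod_congr rfl fun g _ => (hjG g p).trans (hq g)]
  simp

end Cohomology

/-! ### Rational characters are the invariant characters -/

section Descent

variable {K L A B : Type*} [Field K] [Field L] [Algebra K L] [CommRing A] [HopfAlgebra K A]
  [CommRing B] [HopfAlgebra K B]

theorem one_tmul_injective (K L A : Type*) [Field K] [Field L] [Algebra K L] [CommRing A]
    [Algebra K A] : Function.Injective fun a : A => (1 : L) ⊗ₜ[K] a :=
  Algebra.TensorProduct.includeRight_injective (algebraMap K L).injective

/-- Being group-like may be tested after extension of scalars, which is faithfully flat. -/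
theorem isGroupLikeElem_one_tmul_iff {a : A} :
    IsGroupLikeElem L ((1 : L) ⊗ₜ[K] a) ↔ IsGroupLikeElem K a := by
  have hcounit : Coalgebra.counit (R := L) ((1 : L) ⊗ₜ[K] a) =
      algebraMap K L (Coalgebra.counit (R := K) a) := by
    simp [Algebra.smul_def]
  let Φ := TensorProduct.AlgebraTensorModule.tensorTensorTensorComm K L K L L L A A
  have hcomul : Coalgebra.comul (R := L) ((1 : L) ⊗ₜ[K] a) =
      Φ ((1 ⊗ₜ[L] 1) ⊗ₜ[K] Coalgebra.comul (R := K) a) := by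
    rw [TensorProduct.comul_tmul]
    rfl
  have hself : ((1 : L) ⊗ₜ[K] a) ⊗ₜ[L] ((1 : L) ⊗ₜ[K] a) =
      Φ ((1 ⊗ₜ[L] 1) ⊗ₜ[K] (a ⊗ₜ[K] a)) := rfl
  have hinj : Function.Injective fun x : A ⊗[K] A => ((1 : L) ⊗ₜ[L] (1 : L)) ⊗ₜ[K] x :=
    Algebra.TensorProduct.includeRight_injective (A := L ⊗[L] L) (algebraMap K (L ⊗[L] L)).injective
  constructor
  · intro h
    refine ⟨(algebraMap K L).injective ?_, hinj (Φ.injective ?_)⟩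
    · rw [← hcounit, h.counit_eq_one, map_one]
    · exact hcomul.symm.trans (h.comul_eq_tmul_self.trans hself)
  · intro h
    refine ⟨?_, ?_⟩
    · rw [hcounit, h.counit_eq_one, map_one]
    · rw [hcomul, h.comul_eq_tmul_self, hself]

/-- Galois descent for vector spaces: the invariants of `L ⊗ A` come from `A`. -/
theorem exists_one_tmul_eq_of_galoisTwist_eq [FiniteDimensional K L] [IsGalois K L] {x : L ⊗[K] A}
    (hx : ∀ σ : L ≃ₐ[K] L, galoisTwist A σ x = x) : ∃ a : A, (1 : L) ⊗ₜ[K] a = x := by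
  let b := Module.Basis.ofVectorSpace K A
  let b' := b.baseChange L
  have hb' : ∀ i, b' i = 1 ⊗ₜ[K] b i := fun i => b.baseChange_apply L i
  have hcoord : ∀ (σ : L ≃ₐ[K] L) y i, b'.repr (galoisTwist A σ y) i = σ (b'.repr y i) := by
    intro σ y i
    induction y with
    | zero => simp
    | add y z hy hz => simp only [map_add, Finsupp.add_apply, hy, hz]
    | tmul l a => simp [galoisTwist, b', Algebra.smul_def]
  have hfix : ∀ i, ∃ k : K, algebraMap K L k = b'.repr x i := fun i =>
    (IsGalois.mem_range_algebraMap_iff_fixed _).mpr fun σ => by rw [← hcoord, hx]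
  choose k hk using hfix
  refine ⟨∑ i ∈ (b'.repr x).support, k i • b i, ?_⟩
  rw [TensorProduct.tmul_sum]
  conv_rhs => rw [← b'.linearCombination_repr x, Finsupp.linearCombination_apply, Finsupp.sum]
  refine Finset.sum_congr rfl fun i _ => ?_
  rw [hb', ← hk, TensorProduct.tmul_smul, algebraMap_smul]

variable (L A) in
/-- The inclusion `X(T)^G → X(T)` of the characters defined over `K`. -/
def rationalCharacterMap : GroupLike K A →* CharacterGroup K L A where
  toFun a := ⟨1 ⊗ₜ[K] a.val, isGroupLikeElem_one_tmul_iff.mpr a.isGroupLikeElem_val⟩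
  map_one' := rfl
  map_mul' a b := by
    ext
    change (1 : L) ⊗ₜ[K] (a.val * b.val) = (1 ⊗ₜ[K] a.val) * (1 ⊗ₜ[K] b.val)
    rw [Algebra.TensorProduct.tmul_mul_tmul, one_mul]

theorem rationalCharacterMap_injective : Function.Injective (rationalCharacterMap (K := K) L A) :=
  fun _ _ h => GroupLike.val_injective (one_tmul_injective K L A (congrArg GroupLike.val h))

theorem range_rationalCharacterMap [FiniteDimensional K L] [IsGalois K L] :
    (rationalCharacterMap (K := K) L A).range =
      FixedPoints.subgroup (L ≃ₐ[K] L) (CharacterGroup K L A) := by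
  ext χ
  constructor
  · rintro ⟨a, rfl⟩ σ
    ext
    change galoisTwist A σ ((1 : L) ⊗ₜ[K] a.val) = (1 : L) ⊗ₜ[K] a.val
    simp [galoisTwist]
  · intro h
    obtain ⟨a, ha⟩ := exists_one_tmul_eq_of_galoisTwist_eq
      fun σ => congrArg GroupLike.val (h σ)
    exact ⟨⟨a, isGroupLikeElem_one_tmul_iff.mp (ha ▸ χ.isGroupLikeElem_val)⟩,
      GroupLike.val_injective ha⟩

theorem rationalCharacterMap_mem [FiniteDimensional K L] [IsGalois K L] (a : GroupLike K A) :
    rationalCharacterMap L A a ∈ FixedPoints.subgroup (L ≃ₐ[K] L) (CharacterGroup K L A) := by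
  rw [← range_rationalCharacterMap]
  exact ⟨a, rfl⟩

theorem characterMap_rationalCharacterMap (f : A →ₐc[K] B) (a : GroupLike K A) :
    characterMap L f (rationalCharacterMap L A a) = rationalCharacterMap L B (groupLikeMap f a) :=
  rfl

theorem characterMap_smul (f : A →ₐc[K] B) (σ : L ≃ₐ[K] L) (χ : CharacterGroup K L A) :
    characterMap L f (σ • χ) = σ • characterMap L f χ := by
  ext
  have h : ∀ y : L ⊗[K] A, Bialgebra.TensorProduct.map (BialgHom.id L L) f (galoisTwist A σ y) =
      galoisTwist B σ (Bialgebra.TensorProduct.map (BialgHom.id L L) f y) := by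
    intro y
    induction y with
    | zero => simp
    | add y z hy hz => simp only [map_add, hy, hz]
    | tmul l a => rfl
  exact h χ.val

end Descent

/-! ### The characters of a split torus -/

section Split

variable {K L A : Type*} [Field K] [Field L] [Algebra K L] [CommRing A] [HopfAlgebra K A]

/-- The character group of a split torus is a lattice: the group-like elements of a Laurent
polynomial algebra are the monomials. -/
theorem exists_characterGroup_injective (hA : IsTorusSplitBy K L A) :
    ∃ (d : ℕ) (f : Additive (CharacterGroup K L A) →+ (Fin d → ℤ)), Function.Injective f := by
  obtain ⟨d, ⟨e⟩⟩ := hA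
  have h : ∀ χ : CharacterGroup K L A,
      ∃ n : Multiplicative (Fin d → ℤ), AddMonoidAlgebra.of L (Fin d → ℤ) n = e χ.val := fun χ =>
    AddMonoidAlgebra.isGroupLikeElem_iff_mem_range_of.mp (χ.isGroupLikeElem_val.map e)
  choose f hf using h
  have hinj := AddMonoidAlgebra.of_injective (R := L) (M := Fin d → ℤ)
  refine ⟨d, AddMonoidHom.mk' (fun χ => (f χ.toMul).toAdd) fun χ ψ => ?_, fun χ ψ h => ?_⟩
  · refine congrArg Multiplicative.toAdd
      (hinj (a₁ := f (χ.toMul * ψ.toMul)) (a₂ := f χ.toMul * f ψ.toMul) ?_)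
    rw [map_mul, hf, hf, hf, GroupLike.val_mul, map_mul]
  · have h' : f χ.toMul = f ψ.toMul := h
    have h2 := hf χ.toMul
    rw [h', hf] at h2
    exact (GroupLike.val_injective (e.injective h2)).symm

theorem free_finite_rationalCharacters (hA : IsTorusSplitBy K L A) :
    Module.Free ℤ (RationalCharacters K A) ∧ Module.Finite ℤ (RationalCharacters K A) := by
  obtain ⟨d, f, hf⟩ := exists_characterGroup_injective hA
  let g : RationalCharacters K A →ₗ[ℤ] (Fin d → ℤ) :=
    (f.comp (rationalCharacterMap L A).toAdditive).toIntLinearMap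
  have hg : Function.Injective g := hf.comp rationalCharacterMap_injective
  let e := LinearEquiv.ofInjective g hg
  exact ⟨Module.Free.of_equiv e.symm, Module.Finite.equiv e.symm⟩

/-- The characters of a split torus span its ring of regular functions. -/
theorem span_characterGroup (hA : IsTorusSplitBy K L A) :
    Submodule.span L (Set.range (GroupLike.val : CharacterGroup K L A → L ⊗[K] A)) = ⊤ := by
  obtain ⟨d, ⟨e⟩⟩ := hA
  rw [eq_top_iff]
  intro x _
  have h : ∀ y : AddMonoidAlgebra L (Fin d → ℤ), e.symm y ∈
      Submodule.span L (Set.range (GroupLike.val : CharacterGroup K L A → L ⊗[K] A)) := by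
    intro y
    induction y using AddMonoidAlgebra.induction_on with
    | of n =>
      exact Submodule.subset_span
        ⟨⟨_, (AddMonoidAlgebra.isGroupLikeElem_of n).map e.symm⟩, rfl⟩
    | add y z hy hz => rw [map_add]; exact add_mem hy hz
    | smul l y hy => rw [map_smul]; exact Submodule.smul_mem _ _ hy
  have h2 := h (e x)
  rwa [e.symm_apply_apply] at h2

/-- A `G`-invariant homomorphism `u : X(T) → Kˣ` comes from a point of `T(K)`: by linear
independence of characters it defines an `L`-point of the split torus, which descends to `K`. -/
theorem exists_point_of_invariant [FiniteDimensional K L] [IsGalois K L]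
    (hA : IsTorusSplitBy K L A) (u : CharacterGroup K L A →* K)
    (hu : ∀ (σ : L ≃ₐ[K] L) χ, u (σ • χ) = u χ) :
    ∃ t : A →ₐ[K] K, ∀ m : GroupLike K A, t m.val = u (rationalCharacterMap L A m) := by
  let b : Module.Basis (CharacterGroup K L A) L (L ⊗[K] A) :=
    Module.Basis.mk linearIndep_groupLikeVal (span_characterGroup hA).ge
  have hb : ∀ χ, b χ = χ.val := fun χ => Module.Basis.mk_apply _ _ χ
  let E₀ : L ⊗[K] A →ₗ[L] L := b.constr L fun χ => algebraMap K L (u χ)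
  have hE₀ : ∀ χ : CharacterGroup K L A, E₀ χ.val = algebraMap K L (u χ) := fun χ => by
    rw [← hb, b.constr_basis]
  have hmul : ∀ x y, E₀ (x * y) = E₀ x * E₀ y := by
    have h : (LinearMap.mul L (L ⊗[K] A)).compr₂ E₀ = (LinearMap.mul L L).compl₁₂ E₀ E₀ := by
      refine b.ext fun χ => b.ext fun ψ => ?_
      change E₀ (b χ * b ψ) = E₀ (b χ) * E₀ (b ψ)
      rw [hb, hb, ← GroupLike.val_mul, hE₀, hE₀, hE₀, map_mul, map_mul]
    exact fun x y => LinearMap.congr_fun₂ h x y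
  let E : L ⊗[K] A →ₐ[L] L := AlgHom.ofLinearMap E₀
    ((hE₀ 1).trans (by rw [map_one, map_one])) hmul
  have hE : ∀ χ : CharacterGroup K L A, E χ.val = algebraMap K L (u χ) := hE₀
  have hEσ : ∀ (σ : L ≃ₐ[K] L) x, E (galoisTwist A σ x) = σ (E x) := by
    intro σ x
    have hx : x ∈ Submodule.span L (Set.range (GroupLike.val : CharacterGroup K L A → _)) :=
      span_characterGroup hA ▸ Submodule.mem_top
    induction hx using Submodule.span_induction with
    | mem x hx =>
      obtain ⟨χ, rfl⟩ := hx
      have h := hE (σ • χ)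
      rw [hu] at h
      rw [hE, AlgEquiv.commutes]
      exact h
    | zero => simp
    | add x y _ _ hx hy => simp only [map_add, hx, hy]
    | smul l x _ hx => rw [galoisTwist_smul, map_smul, map_smul, hx, smul_eq_mul, smul_eq_mul,
        map_mul]
  let s : A →ₐ[K] L := (E.restrictScalars K).comp Algebra.TensorProduct.includeRight
  have hs : ∀ a, s a ∈ (⊥ : Subalgebra K L) := fun a =>
    Algebra.mem_bot.mpr <| (IsGalois.mem_range_algebraMap_iff_fixed _).mpr fun σ => by
      change σ (E (1 ⊗ₜ[K] a)) = E (1 ⊗ₜ[K] a)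
      rw [← hEσ]
      simp [galoisTwist]
  let t : A →ₐ[K] K := (Algebra.botEquivOfInjective (algebraMap K L).injective).toAlgHom.comp
    (s.codRestrict ⊥ hs)
  have ht : ∀ a, algebraMap K L (t a) = s a := fun a =>
    congrArg Subtype.val ((Algebra.botEquivOfInjective (algebraMap K L).injective).symm_apply_apply
      (s.codRestrict ⊥ hs a))
  exact ⟨t, fun m => (algebraMap K L).injective ((ht _).trans (hE (rationalCharacterMap L A m)))⟩

end Split

/-! ### A place with finite residue field -/

section Places

variable {F K : Type*} [Field F] [Finite F] [Field K] [Algebra F K]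

theorem IsFunctionField.exists_transcendental_isSeparable (hK : IsFunctionField F K) :
    ∃ t : K, Transcendental F t ∧
      FiniteDimensional (IntermediateField.adjoin F {t}) K ∧
      Algebra.IsSeparable (IntermediateField.adjoin F {t}) K := by
  have hft : Algebra.EssFiniteType F K :=
    (Algebra.EssFiniteType.iff_of_algEquiv IntermediateField.topEquiv).mp
      (IntermediateField.essFiniteType_iff.mpr hK.fg)
  obtain ⟨s, hs, hsep⟩ := exists_isTranscendenceBasis_and_isSeparable_of_perfectField F K
  have hcard : s.card = 1 := by
    have h := hs.cardinalMk_eq_trdeg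
    rw [hK.trdeg_eq_one] at h
    simpa using h
  obtain ⟨t, rfl⟩ := Finset.card_eq_one.mp hcard
  rw [Finset.coe_singleton] at hsep
  refine ⟨t, ?_, ?_, hsep⟩
  · exact hs.1.transcendental ⟨t, by simp⟩
  · have : Algebra.EssFiniteType (IntermediateField.adjoin F {t}) K :=
      Algebra.EssFiniteType.of_comp F _ K
    have : Algebra.IsAlgebraic (IntermediateField.adjoin F {t}) K := hsep.isAlgebraic
    exact Algebra.finite_of_essFiniteType_of_isAlgebraic

/-- The place attached to a prime of a Dedekind domain of finite type over `F`. -/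
theorem exists_place_of_isDedekindDomain {O : Type*} [CommRing O] [IsDedekindDomain O]
    [Algebra F O] [Algebra.FiniteType F O] [Algebra O K] [IsFractionRing O K]
    (𝔭 : IsDedekindDomain.HeightOneSpectrum O) : ∃ v : Place K, v.residueDegree F ≠ 0 := by
  let v : Place K := ⟨𝔭.valuation K, 𝔭.valuation_surjective K⟩
  refine ⟨v, ?_⟩
  -- By the Nullstellensatz `O ⧸ 𝔭` is finite over `F`, and it surjects onto the residue field.
  have : Algebra.FiniteType F (O ⧸ 𝔭.asIdeal) :=
    Algebra.FiniteType.trans (S := O) inferInstance inferInstance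
  have : 𝔭.asIdeal.IsMaximal := 𝔭.isMaximal
  let _ : Field (O ⧸ 𝔭.asIdeal) := Ideal.Quotient.field 𝔭.asIdeal
  have : Module.Finite F (O ⧸ 𝔭.asIdeal) :=
    finite_of_finite_type_of_isJacobsonRing F (O ⧸ 𝔭.asIdeal)
  have : Finite (O ⧸ 𝔭.asIdeal) := Module.finite_of_finite F
  have hmem : ∀ a : O, algebraMap O K a ∈ v.valuation.valuationSubring := fun a =>
    𝔭.valuation_le_one a
  let r : O →+* IsLocalRing.ResidueField v.valuation.valuationSubring :=
    (IsLocalRing.residue _).comp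
      ((algebraMap O K).codRestrict v.valuation.valuationSubring.toSubring hmem)
  have hr : Function.Surjective r := by
    intro y
    obtain ⟨x, rfl⟩ := IsLocalRing.residue_surjective y
    obtain ⟨a, ha⟩ := 𝔭.exists_valuation_sub_lt_of_integer (K := K) (x := x.1) x.2 1
    refine ⟨a, sub_eq_zero.mp ?_⟩
    refine (map_sub (IsLocalRing.residue v.valuation.valuationSubring) _ _).symm.trans ?_
    exact (IsLocalRing.residue_eq_zero_iff _).mpr ((v.valuation.mem_maximalIdeal_iff).mpr ha)
  have hrP : ∀ a ∈ 𝔭.asIdeal, r a = 0 := by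
    intro a ha
    exact (IsLocalRing.residue_eq_zero_iff _).mpr
      ((v.valuation.mem_maximalIdeal_iff).mpr ((𝔭.valuation_lt_one_iff_mem a).mpr ha))
  have : Finite (IsLocalRing.ResidueField v.valuation.valuationSubring) :=
    Finite.of_surjective _ (Ideal.Quotient.lift_surjective_of_surjective 𝔭.asIdeal hrP hr)
  let : Module (algebraicClosure F K) (IsLocalRing.ResidueField v.valuation.valuationSubring) :=
    ((IsLocalRing.residue v.valuation.valuationSubring).comp (v.constantsHom F)).toModule
  exact (Module.finrank_pos (R := algebraicClosure F K)
    (M := IsLocalRing.ResidueField v.valuation.valuationSubring)).ne'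

open scoped IntermediateField.algebraAdjoinAdjoin in
/-- The place is attached to a maximal ideal of the integral closure of `F[t]` in `K`, for a
separating transcendental `t`, which exists because `F` is perfect. Separability makes the integral
closure finite over `F[t]`. -/
theorem IsFunctionField.exists_place (hK : IsFunctionField F K) :
    ∃ v : Place K, v.residueDegree F ≠ 0 := by
  obtain ⟨t, ht, hfd, hsep⟩ := hK.exists_transcendental_isSeparable
  let E := IntermediateField.adjoin F {t}
  let R := Algebra.adjoin F {t}
  let e : Polynomial F ≃ₐ[F] R := Polynomial.algEquivOfTranscendental F t ht
  have : IsPrincipalIdealRing R := IsPrincipalIdealRing.of_surjective e.toRingHom e.surjective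
  let O := integralClosure R K
  have : IsDedekindDomain O := integralClosure.isDedekindDomain R E K
  have : IsFractionRing O K := integralClosure.isFractionRing_of_finite_extension E K
  have : Module.Finite R O := IsIntegralClosure.finite R E K O
  have hR : ¬ IsField R := fun h =>
    Polynomial.not_isField F (MulEquiv.isField h e.toMulEquiv)
  have hO : ¬ IsField O := fun h =>
    hR (isField_of_isIntegral_of_isField (FaithfulSMul.algebraMap_injective R O) h)
  obtain ⟨P, hP, hPm⟩ := Ring.not_isField_iff_exists_prime.mp hO
  have : Algebra.FiniteType F R := Algebra.FiniteType.equiv inferInstance e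
  have : Algebra.FiniteType F O := Algebra.FiniteType.trans (S := R) inferInstance inferInstance
  exact exists_place_of_isDedekindDomain ⟨P, hPm, hP⟩

end Places

/-! ### Finiteness of the cokernel of the degree -/

section DegreeFinite

variable {F K L A : Type*} [Field F] [Finite F] [Field K] [Algebra F K] [Field L] [Algebra K L]
  [CommRing A] [HopfAlgebra K A]

theorem Place.ord_algebraMap (v : Place K) (x : K) :
    v.ord (algebraMap K v.Completion x) = -WithZero.log (v.valuation x) :=
  congrArg (fun z => -WithZero.log z) (Valued.valuedCompletion_apply (WithVal.toVal v.valuation x))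

open scoped Classical in
/-- A `K`-point of the torus, placed at the single place `v`, is an adelic point. -/
def adelicPointAt (v : Place K) (t : A →ₐ[K] K) : AdelicPoints (K := K) A :=
  ⟨Pi.mulSingle v (WithConv.toConv ((Algebra.ofId K v.Completion).comp t)), by
    refine Filter.eventually_cofinite.mpr ((Set.finite_singleton v).subset fun w hw => ?_)
    by_contra hne
    refine hw ?_
    rw [Pi.mulSingle_eq_of_ne hne]
    exact one_mem (maximalCompact A w)⟩

theorem adelicDegree_adelicPointAt (v : Place K) (t : A →ₐ[K] K) (m : GroupLike K A) :
    adelicDegree F (adelicPointAt v t) m =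
      (v.residueDegree F : ℤ) * v.ord (algebraMap K v.Completion (t m.val)) := by
  classical
  refine (finsum_eq_single _ v fun w hw => ?_).trans ?_
  · have h1 : adelicPointAt v t w = 1 := Pi.mulSingle_eq_of_ne hw _
    have h2 : w.ord ((1 : LocalPoints A w).ofConv m.val) = 0 :=
      congrArg Multiplicative.toAdd (map_one (localDegree w m))
    rw [h1, h2, mul_zero]
  · have h1 : adelicPointAt v t v = WithConv.toConv ((Algebra.ofId K v.Completion).comp t) :=
      Pi.mulSingle_eq_same v _
    rw [h1]
    rfl

/-- A multiple of every functional on `X(T)^G` is a degree: for `ψ : X(T)^G → ℤ` and a uniformizer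
`x` at `v`, the invariant homomorphism `χ ↦ x ^ ψ (N χ)`, with `N` the norm of `G`, is a point of
`T(K)`. -/
theorem nsmul_mem_degreeImage [FiniteDimensional K L] [IsGalois K L]
    (hA : IsTorusSplitBy K L A) (v : Place K) (ψ : RationalCharacters K A →+ ℤ) :
    (Nat.card (L ≃ₐ[K] L) * v.residueDegree F) • ψ ∈ degreeImage F K A := by
  have := Fintype.ofFinite (L ≃ₐ[K] L)
  obtain ⟨x, hx⟩ := v.surjective (WithZero.exp (-1))
  have hx0 : x ≠ 0 := by
    rintro rfl
    rw [map_zero] at hx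
    exact WithZero.exp_ne_zero hx.symm
  let e : GroupLike K A ≃* FixedPoints.subgroup (L ≃ₐ[K] L) (CharacterGroup K L A) :=
    (MonoidHom.ofInjective rationalCharacterMap_injective).trans
      (MulEquiv.subgroupCongr range_rationalCharacterMap)
  have he : ∀ m, (e m).1 = rationalCharacterMap L A m := fun m => rfl
  let μ : CharacterGroup K L A →* GroupLike K A := e.symm.toMonoidHom.comp (groupNorm (L ≃ₐ[K] L))
  let u : CharacterGroup K L A →* K :=
    { toFun := fun χ => x ^ ψ (Additive.ofMul (μ χ))
      map_one' := by rw [map_one, ofMul_one, map_zero, zpow_zero]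
      map_mul' := fun χ χ' => by rw [map_mul, ofMul_mul, map_add, zpow_add₀ hx0] }
  obtain ⟨t, ht⟩ := exists_point_of_invariant hA u fun σ χ => by
    change x ^ ψ (Additive.ofMul (e.symm (groupNorm _ (σ • χ)))) = _
    rw [groupNorm_smul]
    rfl
  refine ⟨Additive.ofMul (adelicPointAt v t), AddMonoidHom.ext fun m => ?_⟩
  have hμ : μ (rationalCharacterMap L A m.toMul) = m.toMul ^ Fintype.card (L ≃ₐ[K] L) := by
    change e.symm (groupNorm _ (e m.toMul).1) = _
    rw [groupNorm_of_mem, map_pow, e.symm_apply_apply]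
  refine (adelicDegree_adelicPointAt v t m.toMul).trans ?_
  rw [ht, Place.ord_algebraMap]
  change _ * -WithZero.log (v.valuation (x ^ ψ (Additive.ofMul (μ _)))) = _
  rw [hμ, ofMul_pow, map_nsmul, map_zpow₀, hx, WithZero.log_zpow, WithZero.log_exp,
    AddMonoidHom.nsmul_apply, ofMul_toMul, Nat.card_eq_fintype_card]
  simp only [nsmul_eq_mul, smul_eq_mul]
  push_cast
  ring

theorem degreeImage_index_ne_zero [FiniteDimensional K L] [IsGalois K L]
    (hK : IsFunctionField F K) (hA : IsTorusSplitBy K L A) : (degreeImage F K A).index ≠ 0 := by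
  obtain ⟨v, hv⟩ := hK.exists_place
  obtain ⟨_, _⟩ := free_finite_rationalCharacters hA
  have : Module.Finite ℤ (RationalCharacters K A →+ ℤ) :=
    Module.Finite.equiv (addMonoidHomLequivInt ℤ).symm
  exact AddSubgroup.index_ne_zero_of_nsmul_mem _ (mul_ne_zero Nat.card_pos.ne' hv)
    (nsmul_mem_degreeImage hA v)

end DegreeFinite

/-! ### The homology of the degree complex -/

section Main

variable {F K L A B C : Type*} [Field F] [Finite F] [Field K] [Algebra F K] [Field L] [Algebra K L]
  [CommRing A] [HopfAlgebra K A] [CommRing B] [HopfAlgebra K B] [CommRing C] [HopfAlgebra K C]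

theorem IsFlasqueResolution.groupLikeMap_injective {γ : A →ₐc[K] B} {π : B →ₐc[K] C}
    (h : IsFlasqueResolution L γ π) : Function.Injective (groupLikeMap γ) := fun a b hab =>
  rationalCharacterMap_injective (L := L) <| h.injective <| by
    rw [characterMap_rationalCharacterMap, characterMap_rationalCharacterMap, hab]

/-- Left exactness of invariants. -/
theorem IsFlasqueResolution.range_groupLikeMap [FiniteDimensional K L] [IsGalois K L]
    {γ : A →ₐc[K] B} {π : B →ₐc[K] C} (h : IsFlasqueResolution L γ π) :
    (groupLikeMap γ).range = (groupLikeMap π).ker := by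
  have hiff : ∀ b, b ∈ (groupLikeMap π).ker ↔
      rationalCharacterMap L B b ∈ (characterMap L γ).range := fun b => by
    rw [h.exact, MonoidHom.mem_ker, MonoidHom.mem_ker, characterMap_rationalCharacterMap,
      ← map_one (rationalCharacterMap L C), rationalCharacterMap_injective.eq_iff]
  ext b
  rw [hiff]
  constructor
  · rintro ⟨a, rfl⟩
    exact ⟨_, characterMap_rationalCharacterMap γ a⟩
  · rintro ⟨χ, hχ⟩
    have hfix : χ ∈ (rationalCharacterMap L A).range := by
      rw [range_rationalCharacterMap]
      intro σ
      apply h.injective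
      rw [characterMap_smul, hχ]
      exact rationalCharacterMap_mem b σ
    obtain ⟨a, rfl⟩ := hfix
    exact ⟨a, rationalCharacterMap_injective hχ⟩

theorem map_characterMap_fixedPoints [FiniteDimensional K L] [IsGalois K L] (π : B →ₐc[K] C) :
    (FixedPoints.subgroup (L ≃ₐ[K] L) (CharacterGroup K L B)).map (characterMap L π) =
      (groupLikeMap π).range.map (rationalCharacterMap L C) := by
  rw [← range_rationalCharacterMap, MonoidHom.map_range, MonoidHom.map_range]
  rfl

/-- `H¹(G, X(T))` is the cokernel of `X(T_P)^G → X(T_Q)^G`. -/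
theorem IsFlasqueResolution.card_firstCohomology [FiniteDimensional K L] [IsGalois K L]
    {γ : A →ₐc[K] B} {π : B →ₐc[K] C} (h : IsFlasqueResolution L γ π) :
    Nat.card (FirstCohomology (L ≃ₐ[K] L) (CharacterGroup K L A)) =
      (groupLikeMap π).range.index := by
  have htop : (rationalCharacterMap (K := K) L C).range = (⊤ : Subgroup _).map _ :=
    MonoidHom.range_eq_map _
  rw [card_firstCohomology_of_exact h.injective h.exact h.surjective (characterMap_smul γ)
    (characterMap_smul π) h.permutation, map_characterMap_fixedPoints, ← range_rationalCharacterMap,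
    htop,
    Subgroup.relIndex_map_map_of_injective _ _ rationalCharacterMap_injective,
    Subgroup.relIndex_top_right]

theorem IsFlasqueResolution.index_range_groupLikeMap_ne_zero [FiniteDimensional K L] [IsGalois K L]
    {γ : A →ₐc[K] B} {π : B →ₐc[K] C} (h : IsFlasqueResolution L γ π)
    (hC : IsTorusSplitBy K L C) : (groupLikeMap π).toAdditive.range.index ≠ 0 := by
  have := Fintype.ofFinite (L ≃ₐ[K] L)
  obtain ⟨_, _⟩ := free_finite_rationalCharacters hC
  refine AddSubgroup.index_ne_zero_of_nsmul_mem _ (n := Fintype.card (L ≃ₐ[K] L))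
    Fintype.card_ne_zero fun c => ?_
  have h1 := pow_card_mem_map_fixedPoints (G := L ≃ₐ[K] L) h.surjective (characterMap_smul π)
    (rationalCharacterMap_mem c.toMul)
  rw [map_characterMap_fixedPoints, ← map_pow] at h1
  obtain ⟨_, ⟨b, rfl⟩, hb⟩ := h1
  exact ⟨Additive.ofMul b, rationalCharacterMap_injective hb⟩

theorem map_degreeImage_le (f : A →ₐc[K] B) :
    (degreeImage F K B).map (dualCharacterMap f) ≤ degreeImage F K A := by
  rintro _ ⟨x, hx, rfl⟩
  exact (degreeImageMap F f ⟨x, hx⟩).2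

theorem card_degreeMapCokernel (γ : A →ₐc[K] B) :
    Nat.card (DegreeMapCokernel F γ) =
      ((degreeImage F K B).map (dualCharacterMap γ)).relIndex (degreeImage F K A) := by
  have h : (degreeImageMap F γ).range =
      ((degreeImage F K B).map (dualCharacterMap γ)).addSubgroupOf (degreeImage F K A) := by
    ext x
    constructor
    · rintro ⟨y, rfl⟩
      exact ⟨y.1, y.2, rfl⟩
    · rintro ⟨y, hy, hyx⟩
      exact ⟨⟨y, hy⟩, Subtype.ext hyx⟩
  change (degreeImageMap F γ).range.index = _
  rw [h]
  rfl

theorem card_degreeHomology (γ : A →ₐc[K] B) (π : B →ₐc[K] C) :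
    Nat.card (DegreeHomology F γ π) = ((degreeImage F K C).map (dualCharacterMap π)).relIndex
      (degreeImage F K B ⊓ (dualCharacterMap γ).ker) := by
  have h1 : (degreeImageMap F γ).ker.map (degreeImage F K B).subtype =
      degreeImage F K B ⊓ (dualCharacterMap γ).ker := by
    ext x
    constructor
    · rintro ⟨y, hy, rfl⟩
      exact ⟨y.2, congrArg Subtype.val hy⟩
    · rintro ⟨hx, hx'⟩
      exact ⟨⟨x, hx⟩, Subtype.ext hx', rfl⟩
  have h2 : (degreeImageMap F π).range.map (degreeImage F K B).subtype =
      (degreeImage F K C).map (dualCharacterMap π) := by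
    ext x
    constructor
    · rintro ⟨_, ⟨y, rfl⟩, rfl⟩
      exact ⟨y.1, y.2, rfl⟩
    · rintro ⟨y, hy, rfl⟩
      exact ⟨_, ⟨⟨y, hy⟩, rfl⟩, rfl⟩
  rw [← h1, ← h2, AddSubgroup.relIndex_map_map_of_injective _ _ Subtype.val_injective]
  rfl

end Main

end

theorem mainTheorem9 {F K L A B C : Type*} [Field F] [Finite F] [Field K] [Algebra F K]
    (hK : IsFunctionField F K) [Field L] [Algebra K L] [FiniteDimensional K L] [IsGalois K L]
    [CommRing A] [HopfAlgebra K A] [CommRing B] [HopfAlgebra K B] [CommRing C] [HopfAlgebra K C]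
    (hA : IsTorusSplitBy K L A) (hB : IsTorusSplitBy K L B) (hC : IsTorusSplitBy K L C)
    (γ : A →ₐc[K] B) (π : B →ₐc[K] C) (hres : IsFlasqueResolution L γ π) :
    (degreeImageMap F γ).comp (degreeImageMap F π) = 0 ∧
    Finite (FirstCohomology (L ≃ₐ[K] L) (CharacterGroup K L A)) ∧
    Finite (DegreeCokernel F K A) ∧
    Finite (DegreeCokernel F K B) ∧
    Finite (DegreeCokernel F K C) ∧
    Finite (DegreeMapCokernel F γ) ∧
    Finite (DegreeHomology F γ π) ∧
    (Nat.card (DegreeHomology F γ π) : ℚ) =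
      (Nat.card (FirstCohomology (L ≃ₐ[K] L) (CharacterGroup K L A)) : ℚ) *
          (Nat.card (DegreeCokernel F K C) : ℚ) * (Nat.card (DegreeCokernel F K A) : ℚ) *
          (Nat.card (DegreeMapCokernel F γ) : ℚ) /
        (Nat.card (DegreeCokernel F K B) : ℚ) := by
  obtain ⟨_, _⟩ := free_finite_rationalCharacters hC
  -- The complex `Hom(X(T_Q)^G, ℤ) → Hom(X(T_P)^G, ℤ) → Hom(X(T)^G, ℤ)`.
  have hg : Function.Injective (groupLikeMap γ).toAdditive := hres.groupLikeMap_injective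
  have hgf : (groupLikeMap γ).toAdditive.range = (groupLikeMap π).toAdditive.ker :=
    AddSubgroup.ext fun x => (SetLike.ext_iff.mp hres.range_groupLikeMap x.toMul)
  have hf := hres.index_range_groupLikeMap_ne_zero hC
  have hα : Function.Surjective (dualCharacterMap γ) := compHom'_surjective_of_exact hg hgf
  have hcomp : ∀ φ, dualCharacterMap γ (dualCharacterMap π φ) = 0 := fun φ =>
    AddMonoidHom.ext fun a => by
      have h0 : (groupLikeMap π).toAdditive ((groupLikeMap γ).toAdditive a) = 0 :=
        hgf.le ⟨a, rfl⟩
      exact (congrArg φ h0).trans (map_zero φ)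
  have hαβ : (dualCharacterMap π).range ≤ (dualCharacterMap γ).ker := by
    rintro _ ⟨φ, rfl⟩
    exact hcomp φ
  have hβ : Function.Injective (dualCharacterMap π) := by
    refine (injective_iff_map_eq_zero _).mpr fun φ hφ => AddMonoidHom.ext fun c => ?_
    -- A multiple of `c` comes from `X(T_P)^G`, where `φ` vanishes.
    obtain ⟨b, hb⟩ := AddSubgroup.nsmul_index_mem (groupLikeMap π).toAdditive.range c
    have h0 : φ ((groupLikeMap π).toAdditive b) = 0 := DFunLike.congr_fun hφ b
    rw [hb, map_nsmul, smul_eq_zero] at h0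
    exact h0.resolve_left hf
  have key := AddSubgroup.relIndex_map_mul_index_of_complex hβ hα hαβ
    (map_degreeImage_le (F := F) π) (map_degreeImage_le γ)
  rw [← card_degreeHomology, ← card_degreeMapCokernel] at key
  have hH : (dualCharacterMap π).range.relIndex (dualCharacterMap γ).ker =
      Nat.card (FirstCohomology (L ≃ₐ[K] L) (CharacterGroup K L A)) :=
    (relIndex_range_compHom' hgf hf).trans hres.card_firstCohomology.symm
  have hA0 : Nat.card (DegreeCokernel F K A) ≠ 0 := degreeImage_index_ne_zero hK hA
  have hB0 : Nat.card (DegreeCokernel F K B) ≠ 0 := degreeImage_index_ne_zero hK hB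
  have hC0 : Nat.card (DegreeCokernel F K C) ≠ 0 := degreeImage_index_ne_zero hK hC
  have hH0 : Nat.card (FirstCohomology (L ≃ₐ[K] L) (CharacterGroup K L A)) ≠ 0 :=
    hres.card_firstCohomology ▸ hf
  have hK0 : Nat.card (DegreeMapCokernel F γ) ≠ 0 := by
    rw [card_degreeMapCokernel]
    have h1 : ((degreeImage F K B).map (dualCharacterMap γ)).index ≠ 0 :=
      ne_zero_of_dvd_ne_zero (degreeImage_index_ne_zero hK hB) (AddSubgroup.index_map_dvd _ hα)
    rw [← AddSubgroup.relIndex_mul_index (map_degreeImage_le (F := F) γ)] at h1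
    exact left_ne_zero_of_mul h1
  change _ * Nat.card (DegreeCokernel F K B) = _ * Nat.card (DegreeCokernel F K C) *
    (Nat.card (DegreeCokernel F K A) * _) at key
  rw [hH] at key
  have hD0 : Nat.card (DegreeHomology F γ π) ≠ 0 := left_ne_zero_of_mul
    (key ▸ mul_ne_zero (mul_ne_zero hH0 hC0) (mul_ne_zero hA0 hK0))
  refine ⟨AddMonoidHom.ext fun x => Subtype.ext (hcomp x.1), Nat.finite_of_card_ne_zero hH0,
    Nat.finite_of_card_ne_zero hA0, Nat.finite_of_card_ne_zero hB0, Nat.finite_of_card_ne_zero hC0,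
    Nat.finite_of_card_ne_zero hK0, Nat.finite_of_card_ne_zero hD0, ?_⟩
  rw [eq_div_iff (by exact_mod_cast hB0)]
  have h := congrArg (Nat.cast : ℕ → ℚ) key
  push_cast at h
  rw [h]
  ring
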